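/- Let $\mathcal X$ be a nonempty finite set, let $(\mathcal I_n)_{n\in\mathbb N}$ be nonempty finite sets with $|\mathcal I_n|\to\infty$, and set $\mathcal Y_n=\mathcal X^{\mathcal I_n}$. Let $H_n:\mathcal Y_n\to\mathbb R$ be arbitrary functions, and let $\mu_n$ be the Gibbs measure $$\mu_n(\sigma)=Z_n^{-1}e^{H_n(\sigma)},\qquad Z_n=\sum_{\sigma\in\mathcal Y_n}e^{H_n(\sigma)} .$$ For $x\in\mathcal Y_n$ and $i\in\mathcal I_n$ write $\overline x_i=(x_j)_{j\ne i}$, and let $\mu_n(\cdot\mid\overline x_i)$ be the conditional law, under $\mu_n$, of the spin at $i$ given that the other spins are $\overline x_i$. Write $d_{\mathrm{TV}}(p,q)=\frac12\sum_\omega|p(\omega)-q(\omega)|$ for the total variation distance, and put $$I(\mu_n)=\min_{i\in\mathcal I_n}\min_{y\in\mathcal Y_n}\mu_n(y_i\mid\overline y_i).$$ An interdependence matrix of $\mu_n$ is a real matrix $J=(J_{ij})_{i,j\in\mathcal I_n}$ with $J_{ii}=0$ for all $i$ and $d_{\mathrm{TV}}(\mu_n(\cdot\mid\overline x_i),\mu_n(\cdot\mid\overline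 y_i))\le J_{ij}$ for all $i,j\in\mathcal I_n$ and all $x,y\in\mathcal Y_n$ with $\overline x_j=\overline y_j$. Let $\|J\|_{2\to2}$ be its operator norm with respect to the Euclidean norm. The Glauber dynamics of $\mu_n$ has the transition matrix $$P_n(x,y)=|\mathcal I_n|^{-1}\sum_{i\in\mathcal I_n}\mu_n(y_i\mid\overline x_i)\prod_{j\ne i}\delta_{x_j=y_j};$$ its continuous-time semigroup is $P_{n,t}=e^{t(P_n-\mathrm{Id})}$, $t\ge0$, and its mixing time is $$t_{\mathrm{mix}}(n)=\inf\Big\{t\ge0:\ \max_{y\in\mathcal Y_n}d_{\mathrm{TV}}(P_{n,t}(y,\cdot),\mu_n)\le e^{-1}\Big\}.$$ Suppose that there are constants $\alpha_1,\alpha_2\in(0,1)$, not depending on $n$, and interdependence matrices $J_n$ of $\mu_n$ such that for all $n$ $$I(\mu_n)\ge\alpha_1\qquad\text{and}\qquad\|J_n\|_{2\to2}\le1-\alpha_2 .$$ Then the sequence of Glauber dynamics is rapidly mixing: $t_{\mathrm{mix}}(n)<\infty$ for every $n$, and $$t_{\mathrm{mix}}(n)=O\big(|\mathcal I_n|\log|\mathcal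 I_n|\big)\qquad(n\to\infty).$$ -/

import Mathlib

open Filter Asymptotics
open scoped Topology

namespace SpinSystem

noncomputable section

/-- The Gibbs measure `μ(σ) = Z⁻¹ exp (H σ)`, `Z = ∑ σ, exp (H σ)`, on the finite configuration
space `ι → X`, as a probability mass function. -/
def gibbs {ι X : Type*} [Fintype ι] [DecidableEq ι] [Fintype X] (H : (ι → X) → ℝ) :
    (ι → X) → ℝ :=
  fun σ => Real.exp (H σ) / ∑ τ : ι → X, Real.exp (H τ)

/-- The conditional probability `μ(a ∣ x̄ᵢ)` that site `i` has spin `a`, given that the other sites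
have the spins `(x j)_{j ≠ i}`. It does not depend on `x i`. -/
def condProb {ι X : Type*} [DecidableEq ι] [Fintype X] (μ : (ι → X) → ℝ) (i : ι) (x : ι → X)
    (a : X) : ℝ :=
  μ (Function.update x i a) / ∑ b : X, μ (Function.update x i b)

/-- The total variation distance of two probability mass functions on a finite set. -/
def dTV {Ω : Type*} [Fintype Ω] (p q : Ω → ℝ) : ℝ :=
  (1 / 2) * ∑ ω, |p ω - q ω|

/-- The minimal conditional probability `I(μ) = min_i min_y μ(yᵢ ∣ ȳᵢ)`; both minima range over
finite sets, which are nonempty wherever this is used. -/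
def minCondProb {ι X : Type*} [DecidableEq ι] [Fintype X] (μ : (ι → X) → ℝ) : ℝ :=
  ⨅ i : ι, ⨅ y : ι → X, condProb μ i y (y i)

/-- `J` is an interdependence matrix of `μ`: its diagonal vanishes, and `J i j` bounds the total
variation distance of the conditional laws at `i` given any two configurations that agree off
`j`. -/
def IsInterdependenceMatrix {ι X : Type*} [DecidableEq ι] [Fintype X] (μ : (ι → X) → ℝ)
    (J : Matrix ι ι ℝ) : Prop :=
  (∀ i, J i i = 0) ∧
    ∀ i j, ∀ x y : ι → X, (∀ k, k ≠ j → x k = y k) →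
      dTV (condProb μ i x) (condProb μ i y) ≤ J i j

/-- The operator norm `‖J‖_{2 → 2}` of a matrix with respect to the Euclidean norm. -/
def norm22 {ι : Type*} [Fintype ι] [DecidableEq ι] (J : Matrix ι ι ℝ) : ℝ :=
  ‖Matrix.toEuclideanCLM (n := ι) (𝕜 := ℝ) J‖

/-- The transition matrix of the Glauber dynamics:
`P(x, y) = |ι|⁻¹ ∑ᵢ μ(yᵢ ∣ x̄ᵢ) ∏_{j ≠ i} δ_{x_j = y_j}`. -/
def glauber {ι X : Type*} [Fintype ι] [DecidableEq ι] [Fintype X] [DecidableEq X]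
    (μ : (ι → X) → ℝ) : Matrix (ι → X) (ι → X) ℝ :=
  Matrix.of fun x y => (Fintype.card ι : ℝ)⁻¹ *
    ∑ i : ι, condProb μ i x (y i) * ∏ j ∈ Finset.univ.erase i, if x j = y j then 1 else 0

/-- The Glauber semigroup `P_t = exp (t L)` with generator `L = P - 1`; row `y` is the law at time
`t` of the continuous-time Glauber dynamics started in `y`. -/
def glauberSemigroup {ι X : Type*} [Fintype ι] [DecidableEq ι] [Fintype X] [DecidableEq X]
    (μ : (ι → X) → ℝ) (t : ℝ) : Matrix (ι → X) (ι → X) ℝ :=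
  NormedSpace.exp (t • (glauber μ - 1))

/-- The times `t ≥ 0` at which the Glauber dynamics is within total variation distance `e⁻¹` of `μ`,
from every starting configuration. -/
def mixedTimes {ι X : Type*} [Fintype ι] [DecidableEq ι] [Fintype X] [DecidableEq X]
    (μ : (ι → X) → ℝ) : Set ℝ :=
  {t | 0 ≤ t ∧ ∀ y : ι → X, dTV (glauberSemigroup μ t y) μ ≤ Real.exp (-1)}

/-- The mixing time of the Glauber dynamics. (It is meaningful when `mixedTimes μ` is nonempty.) -/
def mixingTime {ι X : Type*} [Fintype ι] [DecidableEq ι] [Fintype X] [DecidableEq X]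
    (μ : (ι → X) → ℝ) : ℝ :=
  sInf (mixedTimes μ)

/-- The sequence of Glauber dynamics of spin systems `μ n` with sites `I n` is rapidly mixing:
all mixing times are finite, and `t_mix = O(|I n| log |I n|)`. -/
def RapidlyMixing {X : Type*} [Fintype X] [DecidableEq X] {I : ℕ → Type*} [∀ n, Fintype (I n)]
    [∀ n, DecidableEq (I n)] (μ : ∀ n, (I n → X) → ℝ) : Prop :=
  (∀ n, (mixedTimes (μ n)).Nonempty) ∧
    (fun n => mixingTime (μ n)) =O[atTop]
      fun n => (Fintype.card (I n) : ℝ) * Real.log (Fintype.card (I n))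

end

end SpinSystem

/-! The proof is Dobrushin's contraction of oscillations. If `d j` bounds the oscillation of `f` at
site `j`, one Glauber step replaces `d` by `oscMatrix J *ᵥ d` (`OscBound.glauber`), and this matrix
has Euclidean norm at most `1 - α / n`, with `n` the number of sites (`norm_oscMatrix_le`). After
`k` steps the total oscillation is at most `n * c * (1 - α / n) ^ k`. The continuous-time semigroup
averages the powers with Poisson weights, so its distance to equilibrium is at most `n * exp (-α t /
n)`, which equals `e⁻¹` at `t = n (log n + 1) / α`. -/

namespace SpinSystem

open Finset Matrix

section Basic

variable {ι X : Type*} [Fintype ι] [DecidableEq ι] [Fintype X]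

/-- `d j` bounds the oscillation of `f` over configurations which differ at most at `j`. -/
def OscBound (f : (ι → X) → ℝ) (d : ι → ℝ) : Prop :=
  ∀ j, ∀ x y : ι → X, (∀ k, k ≠ j → x k = y k) → |f x - f y| ≤ d j

omit [Fintype X] in
lemma OscBound.abs_sub_le {f : (ι → X) → ℝ} {d : ι → ℝ} (h : OscBound f d) (x y : ι → X) :
    |f x - f y| ≤ ∑ j, d j := by
  have key : ∀ s : Finset ι, |f (s.piecewise x y) - f y| ≤ ∑ j ∈ s, d j := by
    intro s
    induction s using Finset.induction_on with
    | empty => simp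
    | insert a s ha ih =>
      have h1 := h a ((insert a s).piecewise x y) (s.piecewise x y) (by
        intro k hk
        simp [Finset.piecewise, hk])
      rw [Finset.sum_insert ha]
      exact (_root_.abs_sub_le _ (f (s.piecewise x y)) _).trans (add_le_add h1 ih)
  simpa using key univ

lemma abs_sum_sub_mul_le {p q g : X → ℝ} {c : ℝ} (hpq : ∑ a, p a = ∑ a, q a)
    (hg : ∀ a b, |g a - g b| ≤ c) : |∑ a, (p a - q a) * g a| ≤ dTV p q * c := by
  rcases isEmpty_or_nonempty X with hX | hX
  · simp [dTV]
  obtain ⟨M, hM⟩ := Finite.exists_max g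
  obtain ⟨m, hm⟩ := Finite.exists_min g
  have h0 : ∑ a, (p a - q a) * g a = ∑ a, (p a - q a) * (g a - (g M + g m) / 2) := by
    simp only [mul_sub, sum_sub_distrib, ← sum_mul]
    rw [hpq]; ring
  rw [h0]
  refine (abs_sum_le_sum_abs _ _).trans ?_
  rw [dTV, mul_assoc, sum_mul, mul_sum]
  refine sum_le_sum fun a _ => ?_
  rw [abs_mul]
  have h1 : |g a - (g M + g m) / 2| ≤ c / 2 := by
    have := le_of_abs_le (hg M m)
    rw [abs_le]
    constructor <;> linarith [hM a, hm a]
  nlinarith [mul_le_mul_of_nonneg_left h1 (abs_nonneg (p a - q a))]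

/-! ### Single-site conditioning and oscillations under a Glauber step -/

section Cond

variable {μ : (ι → X) → ℝ}

omit [Fintype ι] in
lemma condProb_congr (i : ι) {x y : ι → X} (h : ∀ k, k ≠ i → x k = y k) :
    condProb μ i x = condProb μ i y := by
  have : ∀ a, Function.update x i a = Function.update y i a := by
    intro a; ext k
    by_cases hk : k = i
    · subst hk; simp
    · simp [hk, h k hk]
  funext a
  simp [condProb, this]

omit [Fintype ι] in
lemma condProb_nonneg (hμ : ∀ x, 0 < μ x) (i : ι) (x : ι → X) (a : X) : 0 ≤ condProb μ i x a :=
  div_nonneg (hμ _).le (sum_nonneg fun _ _ => (hμ _).le)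

omit [Fintype ι] in
lemma sum_condProb (hμ : ∀ x, 0 < μ x) (i : ι) (x : ι → X) : ∑ a, condProb μ i x a = 1 := by
  have : Nonempty X := ⟨x i⟩
  simp only [condProb, ← sum_div]
  exact div_self (sum_pos (fun _ _ => hμ _) univ_nonempty).ne'

/-- The conditional expectation of `f` given all spins but the one at `i`. -/
noncomputable def condExpectation (μ : (ι → X) → ℝ) (i : ι) (f : (ι → X) → ℝ) (x : ι → X) : ℝ :=
  ∑ a, condProb μ i x a * f (Function.update x i a)

omit [Fintype ι] in
-- Changing site `j` acts twice: on the argument of `f`, at cost `d j`, and on the law used to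
-- resample site `i`, at cost `J i j * d i`.
lemma abs_condExpectation_sub_le (hμ : ∀ x, 0 < μ x) {J : Matrix ι ι ℝ}
    (hJ : IsInterdependenceMatrix μ J) {f : (ι → X) → ℝ} {d : ι → ℝ} (hf : OscBound f d)
    {i j : ι} (hij : i ≠ j) {x y : ι → X} (hxy : ∀ k, k ≠ j → x k = y k) (hd : 0 ≤ d i) :
    |condExpectation μ i f x - condExpectation μ i f y| ≤ d j + J i j * d i := by
  have h1 : condExpectation μ i f x - condExpectation μ i f y =
      ∑ a, condProb μ i x a * (f (Function.update x i a) - f (Function.update y i a)) +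
        ∑ a, (condProb μ i x a - condProb μ i y a) * f (Function.update y i a) := by
    simp only [condExpectation, ← sum_sub_distrib, ← sum_add_distrib]
    exact sum_congr rfl fun a _ => by ring
  rw [h1]
  refine (abs_add_le _ _).trans (add_le_add ?_ ?_)
  · calc _ ≤ ∑ a, condProb μ i x a * d j := by
          refine (abs_sum_le_sum_abs _ _).trans (sum_le_sum fun a _ => ?_)
          rw [abs_mul, abs_of_nonneg (condProb_nonneg hμ i x a)]
          refine mul_le_mul_of_nonneg_left (hf j _ _ fun k hk => ?_) (condProb_nonneg hμ i x a)
          by_cases hki : k = i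
          · subst hki; simp
          · simp [hki, hxy k hk]
      _ = d j := by rw [← sum_mul, sum_condProb hμ, one_mul]
  · refine (abs_sum_sub_mul_le (c := d i) ?_ ?_).trans ?_
    · rw [sum_condProb hμ, sum_condProb hμ]
    · intro a b
      exact hf i _ _ fun k hk => by simp [hk]
    · exact mul_le_mul_of_nonneg_right (hJ.2 i j x y hxy) hd

omit [Fintype ι] in
lemma condExpectation_congr (i : ι) (f : (ι → X) → ℝ) {x y : ι → X}
    (h : ∀ k, k ≠ i → x k = y k) : condExpectation μ i f x = condExpectation μ i f y := by
  have : ∀ a, Function.update x i a = Function.update y i a := by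
    intro a; ext k
    by_cases hk : k = i
    · subst hk; simp
    · simp [hk, h k hk]
  simp [condExpectation, this, condProb_congr i h]

variable [DecidableEq X]

omit [Fintype X] in
lemma prod_erase_eq_ite (i : ι) (x y : ι → X) :
    (∏ j ∈ univ.erase i, if x j = y j then (1 : ℝ) else 0) =
      if ∀ j, j ≠ i → x j = y j then 1 else 0 := by
  rw [prod_ite_zero]
  simp

lemma glauber_mulVec (μ : (ι → X) → ℝ) (f : (ι → X) → ℝ) (x : ι → X) :
    (glauber μ *ᵥ f) x = (Fintype.card ι : ℝ)⁻¹ * ∑ i, condExpectation μ i f x := by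
  simp only [mulVec, dotProduct, glauber, of_apply, mul_assoc, ← mul_sum, sum_mul]
  rw [sum_comm]
  congr 1
  refine sum_congr rfl fun i _ => ?_
  simp only [prod_erase_eq_ite, ite_mul, one_mul, zero_mul, mul_ite, mul_zero]
  rw [← sum_filter, condExpectation]
  symm
  refine sum_bij' (fun a _ => Function.update x i a) (fun y _ => y i) ?_ ?_ ?_ ?_ ?_
  · intro a _
    simp +contextual
  · simp
  · simp
  · intro y hy
    ext k
    by_cases hk : k = i
    · subst hk; simp
    · simp [hk, (mem_filter.1 hy).2 k hk]
  · simp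

lemma glauber_reversible (μ : (ι → X) → ℝ) (x y : ι → X) :
    μ x * glauber μ x y = μ y * glauber μ y x := by
  simp only [glauber, of_apply, prod_erase_eq_ite, mul_sum]
  refine sum_congr rfl fun i _ => ?_
  by_cases h : ∀ j, j ≠ i → x j = y j
  · have h' : ∀ j, j ≠ i → y j = x j := fun j hj => (h j hj).symm
    have e1 : Function.update x i (y i) = y := by
      ext k
      by_cases hk : k = i
      · subst hk; simp
      · simp [hk, h k hk]
    have e2 : Function.update y i (x i) = x := by
      ext k
      by_cases hk : k = i
      · subst hk; simp
      · simp [hk, h' k hk]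
    rw [if_pos h, if_pos h', condProb_congr i h]
    have e3 : condProb μ i y (y i) * μ x = condProb μ i y (x i) * μ y := by
      simp only [condProb, e2, Function.update_eq_self]
      ring
    linear_combination (Fintype.card ι : ℝ)⁻¹ * e3
  · have h' : ¬ ∀ j, j ≠ i → y j = x j := fun h' => h fun j hj => (h' j hj).symm
    rw [if_neg h, if_neg h']
    ring

lemma glauber_mulVec_one [Nonempty ι] (hμ : ∀ x, 0 < μ x) : glauber μ *ᵥ 1 = 1 := by
  ext x
  simp [glauber_mulVec, condExpectation, sum_condProb hμ]

lemma vecMul_glauber [Nonempty ι] (hμ : ∀ x, 0 < μ x) : μ ᵥ* glauber μ = μ := by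
  ext y
  have h := congrFun (glauber_mulVec_one hμ) y
  simp only [mulVec, dotProduct, Pi.one_apply, mul_one] at h
  simp only [vecMul, dotProduct, glauber_reversible μ _ y]
  rw [← mul_sum, h, mul_one]

lemma dotProduct_glauber_pow [Nonempty ι] (hμ : ∀ x, 0 < μ x) (f : (ι → X) → ℝ) (k : ℕ) :
    μ ⬝ᵥ (glauber μ ^ k *ᵥ f) = μ ⬝ᵥ f := by
  induction k with
  | zero => simp
  | succ k ih =>
    rw [pow_succ', ← mulVec_mulVec, dotProduct_mulVec, vecMul_glauber hμ, ih]

/-- The matrix by which one step of the Glauber dynamics transforms bounds on oscillations. -/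
noncomputable def oscMatrix (J : Matrix ι ι ℝ) : Matrix ι ι ℝ :=
  (1 - (Fintype.card ι : ℝ)⁻¹) • (1 : Matrix ι ι ℝ) + (Fintype.card ι : ℝ)⁻¹ • Jᵀ

omit [Fintype ι] [DecidableEq X] in
lemma IsInterdependenceMatrix.nonneg [Nonempty X] {J : Matrix ι ι ℝ}
    (hJ : IsInterdependenceMatrix μ J) (i j : ι) : 0 ≤ J i j := by
  let x : ι → X := fun _ => Classical.arbitrary X
  exact le_trans (by simp [dTV]) (hJ.2 i j x x fun _ _ => rfl)

omit [DecidableEq ι] in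
lemma inv_card_le_one [Nonempty ι] : (Fintype.card ι : ℝ)⁻¹ ≤ 1 :=
  inv_le_one_of_one_le₀ (by exact_mod_cast Fintype.card_pos)

omit [DecidableEq X] in
lemma oscMatrix_mulVec_nonneg [Nonempty ι] [Nonempty X] {J : Matrix ι ι ℝ}
    (hJ : IsInterdependenceMatrix μ J) {d : ι → ℝ} (hd : 0 ≤ d) : 0 ≤ oscMatrix J *ᵥ d := by
  intro j
  simp only [oscMatrix, add_mulVec, smul_mulVec, one_mulVec, Pi.add_apply, Pi.smul_apply,
    smul_eq_mul]
  refine add_nonneg (mul_nonneg (sub_nonneg.2 inv_card_le_one) (hd j))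
    (mul_nonneg (by positivity) ?_)
  exact sum_nonneg fun i _ => mul_nonneg (hJ.nonneg i j) (hd i)

lemma OscBound.glauber [Nonempty ι] (hμ : ∀ x, 0 < μ x) {J : Matrix ι ι ℝ}
    (hJ : IsInterdependenceMatrix μ J) {f : (ι → X) → ℝ} {d : ι → ℝ} (hd : 0 ≤ d)
    (hf : OscBound f d) : OscBound (glauber μ *ᵥ f) (oscMatrix J *ᵥ d) := by
  intro j x y hxy
  rw [glauber_mulVec, glauber_mulVec, ← mul_sub, ← sum_sub_distrib, abs_mul,
    abs_of_nonneg (by positivity)]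
  have hn : (Fintype.card ι : ℝ) ≠ 0 := by exact_mod_cast Fintype.card_ne_zero
  have h1 : (oscMatrix J *ᵥ d) j =
      (Fintype.card ι : ℝ)⁻¹ * ∑ i, ((if i = j then 0 else d j) + J i j * d i) := by
    have : ∑ i : ι, (if i = j then 0 else d j) = (Fintype.card ι - 1) * d j := by
      have h2 : ∀ i : ι, (if i = j then 0 else d j) = d j - if i = j then d j else 0 := by
        intro i; split_ifs <;> simp
      simp only [h2, sum_sub_distrib, sum_const, card_univ, nsmul_eq_mul, sum_ite_eq', mem_univ,
        if_true]
      ring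
    rw [sum_add_distrib, this]
    simp only [oscMatrix, add_mulVec, smul_mulVec, one_mulVec, Pi.add_apply, Pi.smul_apply,
      smul_eq_mul]
    simp only [mulVec, dotProduct, transpose_apply]
    field_simp
  rw [h1]
  refine mul_le_mul_of_nonneg_left ((abs_sum_le_sum_abs _ _).trans (sum_le_sum fun i _ => ?_))
    (by positivity)
  -- Resampling site `j` itself erases the discrepancy there.
  by_cases hij : i = j
  · subst hij
    simp [condExpectation_congr i f hxy, hJ.1 i]
  · simpa [hij] using abs_condExpectation_sub_le hμ hJ hf hij hxy (hd i)

lemma OscBound.glauber_pow [Nonempty ι] [Nonempty X] (hμ : ∀ x, 0 < μ x) {J : Matrix ι ι ℝ}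
    (hJ : IsInterdependenceMatrix μ J) {f : (ι → X) → ℝ} {d : ι → ℝ} (hd : 0 ≤ d)
    (hf : OscBound f d) (k : ℕ) :
    0 ≤ oscMatrix J ^ k *ᵥ d ∧
      OscBound (SpinSystem.glauber μ ^ k *ᵥ f) (oscMatrix J ^ k *ᵥ d) := by
  induction k with
  | zero => simpa using ⟨hd, hf⟩
  | succ k ih =>
    rw [pow_succ', pow_succ', ← mulVec_mulVec, ← mulVec_mulVec]
    exact ⟨oscMatrix_mulVec_nonneg hJ ih.1, ih.2.glauber hμ hJ ih.1⟩

end Cond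

/-! ### Contraction in the Euclidean norm -/

section Norm

open scoped Matrix.Norms.L2Operator

omit [Fintype X] in
lemma norm_oscMatrix_le [Nonempty ι] {J : Matrix ι ι ℝ} {α : ℝ} (hJ : norm22 J ≤ 1 - α) :
    ‖oscMatrix J‖ ≤ 1 - α / Fintype.card ι := by
  have h0 : ‖Jᵀ‖ ≤ 1 - α := by
    rw [← conjTranspose_eq_transpose_of_trivial, l2_opNorm_conjTranspose]
    exact hJ
  have hn : (0 : ℝ) ≤ (Fintype.card ι : ℝ)⁻¹ := by positivity
  refine (norm_add_le _ _).trans ?_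
  rw [norm_smul, norm_smul, norm_one, Real.norm_of_nonneg hn,
    Real.norm_of_nonneg (sub_nonneg.2 inv_card_le_one), div_eq_mul_inv]
  nlinarith [mul_le_mul_of_nonneg_left h0 hn]

/-- Two factors `√n` arise: one from Cauchy–Schwarz, one from the norm of the constant vector. -/
lemma sum_mulVec_const_le [Nonempty ι] (A : Matrix ι ι ℝ) {c : ℝ} (hc : 0 ≤ c) :
    ∑ j, (A *ᵥ fun _ => c) j ≤ Fintype.card ι * c * ‖A‖ := by
  have h1 := l2_opNorm_mulVec A (WithLp.toLp 2 fun _ => c)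
  have h2 : ‖(WithLp.toLp 2 fun _ : ι => c)‖ = √(Fintype.card ι) * c := by
    rw [EuclideanSpace.norm_eq]
    simp [Real.sqrt_sq hc]
  set v := A *ᵥ fun _ => c with hv
  have h3 : ∑ j, v j ≤ √(Fintype.card ι) * ‖WithLp.toLp 2 v‖ := by
    rw [EuclideanSpace.norm_eq, ← Real.sqrt_mul (by positivity)]
    refine Real.le_sqrt_of_sq_le ?_
    simpa using sq_sum_le_card_mul_sum_sq (s := univ) (f := v)
  rw [h2] at h1
  calc _ ≤ √(Fintype.card ι) * ‖WithLp.toLp 2 v‖ := h3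
    _ ≤ √(Fintype.card ι) * (‖A‖ * (√(Fintype.card ι) * c)) :=
        mul_le_mul_of_nonneg_left h1 (Real.sqrt_nonneg _)
    _ = (√(Fintype.card ι) * √(Fintype.card ι)) * c * ‖A‖ := by ring
    _ = _ := by rw [Real.mul_self_sqrt (by positivity)]

lemma abs_glauber_pow_sub_le [DecidableEq X] [Nonempty ι] [Nonempty X] {μ : (ι → X) → ℝ}
    (hμ : ∀ x, 0 < μ x) {J : Matrix ι ι ℝ} (hJ : IsInterdependenceMatrix μ J) {α : ℝ}
    (hα : norm22 J ≤ 1 - α) {f : (ι → X) → ℝ} {c : ℝ} (hf : ∀ x y, |f x - f y| ≤ c)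
    (hc : 0 ≤ c) (k : ℕ) (x y : ι → X) :
    |(glauber μ ^ k *ᵥ f) x - (glauber μ ^ k *ᵥ f) y| ≤
      Fintype.card ι * c * (1 - α / Fintype.card ι) ^ k := by
  have h := (OscBound.glauber_pow hμ hJ (d := fun _ => c) (fun _ => hc)
    (fun _ x y _ => hf x y) k).2
  refine (h.abs_sub_le x y).trans ((sum_mulVec_const_le _ hc).trans ?_)
  refine mul_le_mul_of_nonneg_left ((norm_pow_le _ k).trans ?_) (by positivity)
  exact pow_le_pow_left₀ (norm_nonneg _) (norm_oscMatrix_le hα) k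

end Norm

/-! ### From discrete to continuous time -/

section Semigroup

open scoped Matrix.Norms.Operator

lemma glauberSemigroup_eq [DecidableEq X] (μ : (ι → X) → ℝ) (t : ℝ) :
    glauberSemigroup μ t = Real.exp (-t) • NormedSpace.exp (t • glauber μ) := by
  have h1 : t • (glauber μ - 1) = (-t) • (1 : Matrix (ι → X) (ι → X) ℝ) + t • glauber μ := by
    rw [smul_sub, neg_smul]; abel
  have h2 : NormedSpace.exp ((-t) • (1 : Matrix (ι → X) (ι → X) ℝ)) =
      Real.exp (-t) • (1 : Matrix (ι → X) (ι → X) ℝ) := by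
    rw [smul_one_eq_diagonal, Matrix.exp_diagonal, smul_one_eq_diagonal]
    congr 1
    ext i
    rw [Pi.coe_exp, Real.exp_eq_exp_ℝ]
  rw [glauberSemigroup, h1,
    Matrix.exp_add_of_commute _ _ ((Commute.one_left _).smul_left _), h2, smul_mul_assoc, one_mul]

lemma hasSum_exp_mulVec {m : Type*} [Fintype m] [DecidableEq m] (A : Matrix m m ℝ) (t : ℝ)
    (f : m → ℝ) (y : m) :
    HasSum (fun k : ℕ => (t ^ k / k.factorial) * (A ^ k *ᵥ f) y)
      ((NormedSpace.exp (t • A) *ᵥ f) y) := by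
  have h := NormedSpace.exp_series_hasSum_exp' (𝕂 := ℝ) (t • A)
  let φ : Matrix m m ℝ →ₗ[ℝ] ℝ :=
    { toFun := fun M => (M *ᵥ f) y
      map_add' := fun M N => by simp [add_mulVec]
      map_smul' := fun r M => by simp [smul_mulVec] }
  have h2 := h.mapL (LinearMap.toContinuousLinearMap φ)
  have e : ∀ k : ℕ, LinearMap.toContinuousLinearMap φ ((k.factorial : ℝ)⁻¹ • (t • A) ^ k) =
      (t ^ k / k.factorial) * (A ^ k *ᵥ f) y := by
    intro k
    rw [smul_pow, map_smul, map_smul]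
    change _ * (_ * (A ^ k *ᵥ f) y) = _
    ring
  exact (funext e : _ = fun k : ℕ => _) ▸ h2

end Semigroup

lemma hasSum_real_exp (x : ℝ) : HasSum (fun k : ℕ => x ^ k / k.factorial) (Real.exp x) := by
  rw [Real.exp_eq_exp_ℝ]
  exact NormedSpace.expSeries_div_hasSum_exp x

lemma dTV_glauberSemigroup_le [DecidableEq X] [Nonempty ι] [Nonempty X] {μ : (ι → X) → ℝ}
    (hμ : ∀ x, 0 < μ x) (hμ1 : ∑ x, μ x = 1) {J : Matrix ι ι ℝ}
    (hJ : IsInterdependenceMatrix μ J) {α : ℝ} (hα : norm22 J ≤ 1 - α) {t : ℝ} (ht : 0 ≤ t)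
    (y : ι → X) :
    dTV (glauberSemigroup μ t y) μ ≤ Fintype.card ι * Real.exp (-(α * t / Fintype.card ι)) := by
  set n : ℝ := (Fintype.card ι : ℝ)
  -- This sign function attains the total variation distance; its oscillation, at most 2, cancels
  -- the factor 1/2.
  set f : (ι → X) → ℝ := fun x => SignType.sign (glauberSemigroup μ t y x - μ x) with hf
  have hf1 : ∀ x, |f x| ≤ 1 := by
    intro x
    rcases lt_trichotomy (glauberSemigroup μ t y x - μ x) 0 with h | h | h <;> simp [hf, h]
  have hf2 : ∀ x z, |f x - f z| ≤ 2 := fun x z =>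
    (abs_sub _ _).trans (by linarith [hf1 x, hf1 z])
  have e1 : dTV (glauberSemigroup μ t y) μ =
      (1 / 2) * ((glauberSemigroup μ t *ᵥ f) y - μ ⬝ᵥ f) := by
    simp only [dTV, mulVec, dotProduct, ← sum_sub_distrib, ← sub_mul]
    congr 1
    exact sum_congr rfl fun x _ => (self_mul_sign _).symm
  have e2 : (glauberSemigroup μ t *ᵥ f) y - μ ⬝ᵥ f = Real.exp (-t) *
      ((NormedSpace.exp (t • glauber μ) *ᵥ f) y - Real.exp t * μ ⬝ᵥ f) := by
    rw [glauberSemigroup_eq, smul_mulVec, Pi.smul_apply, smul_eq_mul, mul_sub, ← mul_assoc,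
      ← Real.exp_add, neg_add_cancel, Real.exp_zero, one_mul]
  have h3 : ∀ k : ℕ, |(glauber μ ^ k *ᵥ f) y - μ ⬝ᵥ f| ≤ n * 2 * (1 - α / n) ^ k := by
    intro k
    -- Stationarity turns the distance from the mean into a `μ`-average of differences between
    -- starting points.
    have : (glauber μ ^ k *ᵥ f) y - μ ⬝ᵥ f =
        ∑ x, μ x * ((glauber μ ^ k *ᵥ f) y - (glauber μ ^ k *ᵥ f) x) := by
      rw [← dotProduct_glauber_pow hμ f k]
      simp only [mul_sub, sum_sub_distrib, ← sum_mul, hμ1, one_mul, dotProduct]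
    rw [this]
    calc _ ≤ ∑ x, μ x * (n * 2 * (1 - α / n) ^ k) := by
          refine (abs_sum_le_sum_abs _ _).trans (sum_le_sum fun x _ => ?_)
          rw [abs_mul, abs_of_pos (hμ x)]
          exact mul_le_mul_of_nonneg_left
            (abs_glauber_pow_sub_le hμ hJ hα hf2 zero_le_two k y x) (hμ x).le
      _ = _ := by rw [← sum_mul, hμ1, one_mul]
  have h4 := (hasSum_exp_mulVec (glauber μ) t f y).sub ((hasSum_real_exp t).mul_right (μ ⬝ᵥ f))
  have h5 := (hasSum_real_exp (t * (1 - α / n))).mul_left (n * 2)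
  have h6 := h4.norm_le_of_bounded h5 fun k => by
    rw [← mul_sub, norm_mul, Real.norm_of_nonneg (by positivity), Real.norm_eq_abs, mul_pow]
    refine (mul_le_mul_of_nonneg_left (h3 k) (by positivity)).trans (le_of_eq ?_)
    ring
  have h7 : Real.exp (-(α * t / n)) = Real.exp (-t) * Real.exp (t * (1 - α / n)) := by
    rw [← Real.exp_add]; congr 1; ring
  rw [e1, e2, h7]
  have h8 := mul_le_mul_of_nonneg_left ((le_abs_self _).trans h6) (Real.exp_pos (-t)).le
  linarith

lemma mem_mixedTimes [DecidableEq X] [Nonempty ι] [Nonempty X] {μ : (ι → X) → ℝ}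
    (hμ : ∀ x, 0 < μ x) (hμ1 : ∑ x, μ x = 1) {J : Matrix ι ι ℝ}
    (hJ : IsInterdependenceMatrix μ J) {α : ℝ} (hα0 : 0 < α) (hα : norm22 J ≤ 1 - α) :
    Fintype.card ι * (Real.log (Fintype.card ι) + 1) / α ∈ mixedTimes μ := by
  have hn : (1 : ℝ) ≤ Fintype.card ι := by exact_mod_cast Fintype.card_pos
  have ht : 0 ≤ Fintype.card ι * (Real.log (Fintype.card ι) + 1) / α := by
    have := Real.log_nonneg hn
    positivity
  refine ⟨ht, fun y => (dTV_glauberSemigroup_le hμ hμ1 hJ hα ht y).trans (le_of_eq ?_)⟩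
  have e : α * (Fintype.card ι * (Real.log (Fintype.card ι) + 1) / α) / Fintype.card ι =
      Real.log (Fintype.card ι) + 1 := by
    field_simp
  rw [e, neg_add, Real.exp_add, Real.exp_neg, Real.exp_log (by positivity), ← mul_assoc,
    mul_inv_cancel₀ (by positivity), one_mul]

lemma gibbs_pos (H : (ι → X) → ℝ) (x : ι → X) : 0 < gibbs H x :=
  div_pos (Real.exp_pos _) (sum_pos (fun _ _ => Real.exp_pos _) ⟨x, mem_univ x⟩)

lemma sum_gibbs [Nonempty X] (H : (ι → X) → ℝ) : ∑ x, gibbs H x = 1 := by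
  simp only [gibbs, ← sum_div]
  exact div_self (sum_pos (fun _ _ => Real.exp_pos _) univ_nonempty).ne'

end Basic

end SpinSystem

theorem corollary2p3 {X : Type*} [Fintype X] [DecidableEq X] [Nonempty X]
    {I : ℕ → Type*} [∀ n, Fintype (I n)] [∀ n, DecidableEq (I n)] [∀ n, Nonempty (I n)]
    (hI : Tendsto (fun n => Fintype.card (I n)) atTop atTop)
    (H : ∀ n, (I n → X) → ℝ)
    (J : ∀ n, Matrix (I n) (I n) ℝ)
    (hJ : ∀ n, SpinSystem.IsInterdependenceMatrix (SpinSystem.gibbs (H n)) (J n))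
    (α₁ α₂ : ℝ) (hα₁ : α₁ ∈ Set.Ioo (0 : ℝ) 1) (hα₂ : α₂ ∈ Set.Ioo (0 : ℝ) 1)
    (hmin : ∀ n, α₁ ≤ SpinSystem.minCondProb (SpinSystem.gibbs (H n)))
    (hnorm : ∀ n, SpinSystem.norm22 (J n) ≤ 1 - α₂) :
    SpinSystem.RapidlyMixing (fun n => SpinSystem.gibbs (H n)) := by
  have hmem := fun n => SpinSystem.mem_mixedTimes (SpinSystem.gibbs_pos (H n))
    (SpinSystem.sum_gibbs (H n)) (hJ n) hα₂.1 (hnorm n)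
  refine ⟨fun n => ⟨_, hmem n⟩, IsBigO.of_bound (2 / α₂) ?_⟩
  -- Since `e < 3`, the logarithm is then at least 1, so `log n + 1 ≤ 2 * log n`; hence the constant
  -- `2 / α₂`.
  filter_upwards [hI.eventually_ge_atTop 3] with n hn
  have hbdd : BddBelow (SpinSystem.mixedTimes (SpinSystem.gibbs (H n))) := ⟨0, fun t ht => ht.1⟩
  have h0 : 0 ≤ SpinSystem.mixingTime (SpinSystem.gibbs (H n)) :=
    Real.sInf_nonneg fun t ht => ht.1
  have h1 : SpinSystem.mixingTime (SpinSystem.gibbs (H n)) ≤ _ := csInf_le hbdd (hmem n)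
  have hn3 : (3 : ℝ) ≤ Fintype.card (I n) := by exact_mod_cast hn
  have hlog : 1 ≤ Real.log (Fintype.card (I n)) := by
    rw [Real.le_log_iff_exp_le (by linarith)]
    linarith [Real.exp_one_lt_d9]
  have hα := hα₂.1
  rw [Real.norm_of_nonneg h0, Real.norm_of_nonneg (by positivity)]
  refine h1.trans ?_
  rw [div_mul_eq_mul_div]
  refine div_le_div_of_nonneg_right ?_ hα.le
  nlinarith
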